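/- Consider the multi-demand auction model with a finite nonempty set $M$ of bidders, a finite set $N$ of item types, and $u(i)\ge 1$ units of each $i\in N$ supplied. A bundle is an integer vector $x$ with $\mathbf 0\le x\le u$. Each bidder $b$ has a valuation $v_b:[\mathbf 0,u]_{\mathbb Z}\to\mathbb Z$ that is monotone nondecreasing with $v_b(\mathbf 0)=0$ and is M$^\natural$-concave: for all $x,y\in[\mathbf 0,u]_{\mathbb Z}$ and every $i\in N$ with $x(i)>y(i)$ there is $k\in\{j\in N: x(j)<y(j)\}\cup\{0\}$ with $$v_b(x)+v_b(y)\le v_b(x-\chi_i+\chi_k)+v_b(y+\chi_i-\chi_k),$$ where $\chi_i$ is the $i$-th unit vector and $\chi_0=\mathbf 0$. For $p\in\mathbb Z_+^N$ let $D_b(p)=\arg\max\{v_b(x)-p^\top x : x\in[\mathbf 0,u]_{\mathbb Z}\}$. The vector $p\in\mathbb Z^N_+$ is a (Walrasian) equilibrium price vector if there are $x_b\in D_b(p)$ $(b\in M)$ with $\sum_{b\in M}x_b=u$. For $X\subseteq N$ write $y(X)=\sum_{i\in X}y(i)$, $\mu_b(X;p)=\min\{y(X): y\in D_b(p)\}$,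 and let $\chi_X\in\{0,1\}^N$ be the characteristic vector of $X$. The set $X$ is overdemanded at $p$ if $\sum_{b}\mu_b(X;p)>u(X)$. A nonempty set $X$ is an excess-demand set at $p$ if $$\sum_{b\in M}\bigl(\mu_b(X;p)-\mu_b(X\setminus Z;p)\bigr)>u(Z)\qquad\text{for every nonempty } Z\subseteq X.$$ The Ascending Auction algorithm starts with $p:=p^\circ$, where $p^\circ\in\mathbb Z_+^N$; as long as some set is overdemanded at $p$, it selects an overdemanded set $X$ at $p$ and sets $p:=p+\chi_X$; it stops when no set is overdemanded at $p$. Theorem. There is a unique minimal equilibrium price vector $\underline p^*$ (it is componentwise least among all equilibrium price vectors). For every $p^\circ\in\mathbb Z_+^N$ with $p^\circ\le\underline p^*$, the Ascending Auction algorithm started at $p^\circ$ finds $\underline p^*$ if, in each iteration, the selected set $X$ is an excess-demand set at the current price $p$. That is, such a set $X$ is available in every iteration that is reached, and, however these sets are chosen, the algorithm stops after finitely many iterations and the price vector at which it stops is $\underline p^*$. -/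

import Mathlib

/-- The characteristic (0-1) vector of a set `X` of item types. -/
def chi {N : Type*} [DecidableEq N] (X : Finset N) : N → ℤ :=
  fun i => if i ∈ X then 1 else 0

/-- The multi-demand auction model with finite bidder set `M` and finite set `N` of item types.
Bundles are the integer vectors of the box `Set.Icc 0 u`; only the values of `v b` on that box
are ever used. -/
structure MultiDemandModel (M N : Type*) where
  /-- `u i` is the number of supplied units of item type `i` -/
  u : N → ℤ
  u_pos : ∀ i, 0 < u i
  /-- `v b x` is the value of the bundle `x` to bidder `b` -/
  v : M → (N → ℤ) → ℤ
  v_zero : ∀ b, v b 0 = 0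
  v_mono : ∀ b, MonotoneOn (v b) (Set.Icc 0 u)

/-- `M♮`-concavity of a valuation on the integer box `[0, u]`: the exchange axiom. The first
alternative is the exchange with the artificial element `0`, whose unit vector is zero. -/
def MNatConcave {N : Type*} [DecidableEq N] (u : N → ℤ) (v : (N → ℤ) → ℤ) : Prop :=
  ∀ x ∈ Set.Icc 0 u, ∀ y ∈ Set.Icc 0 u, ∀ i, 0 < (x - y) i →
    (v x + v y ≤ v (x - chi {i}) + v (y + chi {i})) ∨
    ∃ k, (x - y) k < 0 ∧
      v x + v y ≤ v (x - chi {i} + chi {k}) + v (y + chi {i} - chi {k})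

namespace MultiDemandModel

variable {M N : Type*} [Fintype N] [DecidableEq N]

/-- The demand set `D_b(p)`: the bundles `x ∈ [0, u]` maximizing `v_b(x) - pᵀ x`. -/
def demand (A : MultiDemandModel M N) (b : M) (p : N → ℤ) : Set (N → ℤ) :=
  {x | x ∈ Set.Icc 0 A.u ∧ ∀ y ∈ Set.Icc 0 A.u, A.v b y - p ⬝ᵥ y ≤ A.v b x - p ⬝ᵥ x}

/-- An allocation distributes the whole supply `u` among the bidders. -/
def IsAllocation [Fintype M] (A : MultiDemandModel M N) (x : M → N → ℤ) : Prop :=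
  (∀ b, x b ∈ Set.Icc 0 A.u) ∧ ∑ b, x b = A.u

/-- `p` (a nonnegative integer vector) is a Walrasian equilibrium price vector. -/
def IsEquilibriumPrice [Fintype M] (A : MultiDemandModel M N) (p : N → ℤ) : Prop :=
  0 ≤ p ∧ ∃ x : M → N → ℤ, A.IsAllocation x ∧ ∀ b, x b ∈ A.demand b p

/-- `μ_b(X; p) = min {y(X) | y ∈ D_b(p)}`; see `isLeast_mu` for the minimum being attained. -/
noncomputable def mu (A : MultiDemandModel M N) (b : M) (X : Finset N) (p : N → ℤ) : ℤ :=
  sInf ((fun y : N → ℤ => ∑ i ∈ X, y i) '' A.demand b p)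

theorem demand_nonempty (A : MultiDemandModel M N) (b : M) (p : N → ℤ) :
    (A.demand b p).Nonempty := by
  have h0 : (Finset.Icc 0 A.u).Nonempty :=
    ⟨0, Finset.mem_Icc.2 ⟨le_rfl, fun i => (A.u_pos i).le⟩⟩
  obtain ⟨x, hx, hmax⟩ := Finset.exists_max_image _ (fun x => A.v b x - p ⬝ᵥ x) h0
  exact ⟨x, Finset.mem_Icc.1 hx, fun y hy => hmax y (Finset.mem_Icc.2 hy)⟩

theorem isLeast_mu (A : MultiDemandModel M N) (b : M) (X : Finset N) (p : N → ℤ) :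
    IsLeast ((fun y : N → ℤ => ∑ i ∈ X, y i) '' A.demand b p) (A.mu b X p) := by
  have hne := (A.demand_nonempty b p).image (fun y : N → ℤ => ∑ i ∈ X, y i)
  have hbdd : BddBelow ((fun y : N → ℤ => ∑ i ∈ X, y i) '' A.demand b p) := by
    refine ⟨0, ?_⟩
    rintro _ ⟨y, hy, rfl⟩
    exact Finset.sum_nonneg fun i _ => hy.1.1 i
  exact ⟨Int.csInf_mem hne hbdd, fun z hz => csInf_le hbdd hz⟩

/-- `X` is overdemanded at price `p`: `∑_b μ_b(X; p) > u(X)`. -/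
def IsOverdemanded [Fintype M] (A : MultiDemandModel M N) (p : N → ℤ) (X : Finset N) : Prop :=
  ∑ i ∈ X, A.u i < ∑ b, A.mu b X p

/-- `X` is an excess-demand set at price `p`. -/
def IsExcessDemand [Fintype M] (A : MultiDemandModel M N) (p : N → ℤ) (X : Finset N) : Prop :=
  X.Nonempty ∧ ∀ Z ⊆ X, Z.Nonempty →
    ∑ i ∈ Z, A.u i < ∑ b, (A.mu b X p - A.mu b (X \ Z) p)

/-- The stopping criterion of the ascending auction: there is no overdemanded set at `p`. -/
def Stops [Fintype M] (A : MultiDemandModel M N) (p : N → ℤ) : Prop :=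
  ∀ X : Finset N, ¬ A.IsOverdemanded p X

/-- One iteration of the ascending auction, from price `p` to price `q`, in which the overdemanded
set `X` that is selected also obeys the selection rule `rule p X`. -/
def AuctionStep [Fintype M] (A : MultiDemandModel M N) (rule : (N → ℤ) → Finset N → Prop)
    (p q : N → ℤ) : Prop :=
  ∃ X : Finset N, A.IsOverdemanded p X ∧ rule p X ∧ q = p + chi X

/-- The ascending auction started at `p₀`, run with any choices that obey `rule` in each iteration,
finds `pOut`: it never gets stuck (whenever it does not stop, an admissible set exists), it
terminates after finitely many iterations, and the price at which it stops is `pOut`. -/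
def AscendingAuctionFinds [Fintype M] (A : MultiDemandModel M N) (rule : (N → ℤ) → Finset N → Prop)
    (p₀ pOut : N → ℤ) : Prop :=
  (∀ p, Relation.ReflTransGen (A.AuctionStep rule) p₀ p → ¬ A.Stops p →
    ∃ q, A.AuctionStep rule p q) ∧
  (¬ ∃ P : ℕ → N → ℤ, P 0 = p₀ ∧ ∀ t, A.AuctionStep rule (P t) (P (t + 1))) ∧
  (∀ p, Relation.ReflTransGen (A.AuctionStep rule) p₀ p → A.Stops p → p = pOut)

end MultiDemandModel

/-!
The equilibrium prices are the nonnegative minimizers of the Lyapunov function `L(p) = ∑ b, V_b(p)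
+ pᵀ u`, where `V_b` is the indirect utility of bidder `b`, and the auction descends along `L`
from below.

Valuations being integral, an exchange argument yields `V_b(p + χ_X) = V_b(p) - μ_b(X; p)`
(`indirectUtility_add_chi`). So `X` is overdemanded at `p` iff `L(p + χ_X) < L(p)`, and a nonempty `X` is an
excess-demand set iff `L(p + χ_X) < L(p + χ_Y)` for all proper subsets `Y` of `X`. The same
formula reduces submodularity of `L` on unit squares to `μ_b({i}) + μ_b({j}) ≤ μ_b({i, j})`.

By weak duality, equilibrium prices minimize `L`. Conversely, at a minimizer `p` the supply `u`
obeys the inequalities `∑ b, min y_b(R) ≤ u(R) ≤ ∑ b, max y_b(R)`, the extrema being taken over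
the demand sets. Since demand sets are `M♮`-convex, `u` is then a sum of demanded bundles
(`exists_sum_eq_of_isMNatConvexSet`): choose `x_b ∈ D_b(p)` with `∑ b, x_b` nearest to `u`. If
some item is in excess, exchanges along a shortest path of the exchange graph bring the sum closer
to `u`, unless the set `R` of items reachable from the excess violates the first inequality;
deficits are treated by reflection.

Submodularity makes the set of minimizers closed under meets, which gives a least equilibrium
price `q`. For `p ≤ q` and an excess-demand set `X`, it also shows `p + χ_X ≤ q`
(`IsExcessDemand.add_chi_le`), so the prices stay below `q`. If no set is overdemanded at `p ≤ q`,
then `L(p) ≤ L(q)`: bundles in `D_b(p)` minimizing `(q - p)ᵀ y` minimize `y(X)` on all level sets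
`X` of `q - p` at once (`Stops.lyapunov_le`). So `p` is an equilibrium price too, and `p = q`.
-/

/-! ### Exchange properties -/

/-- The unit vector `χ_k`, where `none` is the artificial element `0` with `χ_0 = 0`. -/
def unitVec {N : Type*} [DecidableEq N] (k : Option N) : N → ℤ :=
  fun j => if k = some j then 1 else 0

/-- `M♮`-concavity of `w` on a set `B` of integer vectors; the exchange is required to stay
inside `B`. -/
def MNatConcaveOn {N : Type*} [DecidableEq N] (B : Set (N → ℤ)) (w : (N → ℤ) → ℤ) : Prop :=
  ∀ x ∈ B, ∀ y ∈ B, ∀ i, y i < x i → ∃ k : Option N, (∀ j, k = some j → x j < y j) ∧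
    x - unitVec (some i) + unitVec k ∈ B ∧ y + unitVec (some i) - unitVec k ∈ B ∧
    w x + w y ≤ w (x - unitVec (some i) + unitVec k) + w (y + unitVec (some i) - unitVec k)

/-- `M♮`-convex sets of integer vectors. -/
def IsMNatConvexSet {N : Type*} [DecidableEq N] (D : Set (N → ℤ)) : Prop :=
  ∀ x ∈ D, ∀ y ∈ D, ∀ i, y i < x i → ∃ k : Option N, (∀ j, k = some j → x j < y j) ∧
    x - unitVec (some i) + unitVec k ∈ D ∧ y + unitVec (some i) - unitVec k ∈ D

section Exchange

variable {N : Type*} [DecidableEq N]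

@[simp] theorem unitVec_none : unitVec (none : Option N) = 0 := by
  ext j; simp [unitVec]

theorem chi_singleton (i : N) : chi {i} = unitVec (some i) := by
  ext j; simp [unitVec, chi, eq_comm]

theorem sum_unitVec_mem (k : Option N) (X : Finset N) :
    0 ≤ ∑ j ∈ X, unitVec k j ∧ ∑ j ∈ X, unitVec k j ≤ 1 := by
  cases k with
  | none => simp
  | some i => simp only [unitVec, Option.some.injEq, Finset.sum_ite_eq]; split_ifs <;> simp

theorem sum_unitVec_of_mem {i : N} {X : Finset N} (h : i ∈ X) :
    ∑ j ∈ X, unitVec (some i) j = 1 := by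
  simp [unitVec, h]

theorem MNatConcaveOn.neg {B : Set (N → ℤ)} {w : (N → ℤ) → ℤ} (h : MNatConcaveOn B w) :
    MNatConcaveOn {x | -x ∈ B} (fun x => w (-x)) := by
  intro x hx y hy i hi
  obtain ⟨k, hk, h1, h2, h3⟩ := h (-y) hy (-x) hx i (by simpa using hi)
  refine ⟨k, fun j hj => by simpa using hk j hj, ?_, ?_, ?_⟩
  · have : -(x - unitVec (some i) + unitVec k) = -x + unitVec (some i) - unitVec k := by abel
    simpa only [Set.mem_ofPred_eq, this] using h2
  · have : -(y + unitVec (some i) - unitVec k) = -y - unitVec (some i) + unitVec k := by abel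
    simpa only [Set.mem_ofPred_eq, this] using h1
  · have e1 : -(x - unitVec (some i) + unitVec k) = -x + unitVec (some i) - unitVec k := by abel
    have e2 : -(y + unitVec (some i) - unitVec k) = -y - unitVec (some i) + unitVec k := by abel
    simp only [e1, e2]
    linarith

theorem IsMNatConvexSet.neg {D : Set (N → ℤ)} (h : IsMNatConvexSet D) :
    IsMNatConvexSet {x | -x ∈ D} := by
  intro x hx y hy i hi
  obtain ⟨k, hk, h1, h2⟩ := h (-y) hy (-x) hx i (by simpa using hi)
  refine ⟨k, fun j hj => by simpa using hk j hj, ?_, ?_⟩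
  · have : -(x - unitVec (some i) + unitVec k) = -x + unitVec (some i) - unitVec k := by abel
    simpa only [Set.mem_ofPred_eq, this] using h2
  · have : -(y + unitVec (some i) - unitVec k) = -y - unitVec (some i) + unitVec k := by abel
    simpa only [Set.mem_ofPred_eq, this] using h1

theorem MNatConcaveOn.sub_linear [Fintype N] {B : Set (N → ℤ)} {w : (N → ℤ) → ℤ}
    (h : MNatConcaveOn B w) (p : N → ℤ) : MNatConcaveOn B (fun x => w x - p ⬝ᵥ x) := by
  intro x hx y hy i hi
  obtain ⟨k, hk, h1, h2, h3⟩ := h x hx y hy i hi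
  refine ⟨k, hk, h1, h2, ?_⟩
  simp only [dotProduct_add, dotProduct_sub]
  linarith

theorem MNatConcaveOn.argmax {B : Set (N → ℤ)} {w : (N → ℤ) → ℤ} (h : MNatConcaveOn B w) :
    IsMNatConvexSet {x | x ∈ B ∧ ∀ y ∈ B, w y ≤ w x} := by
  rintro x ⟨hx, hx'⟩ y ⟨hy, hy'⟩ i hi
  obtain ⟨k, hk, h1, h2, h3⟩ := h x hx y hy i hi
  have a1 := hx' _ h1
  have a2 := hy' _ h2
  have a3 := hx' _ hy
  have a4 := hy' _ hx
  refine ⟨k, hk, ⟨h1, fun z hz => ?_⟩, ⟨h2, fun z hz => ?_⟩⟩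
  · have := hx' z hz; linarith
  · have := hx' z hz; linarith

theorem MNatConcave.mNatConcaveOn {u : N → ℤ} {v : (N → ℤ) → ℤ} (h : MNatConcave u v) :
    MNatConcaveOn (Set.Icc 0 u) v := by
  -- Exchanges never leave the box: a raised coordinate lies below that of the other vector.
  have box : ∀ x ∈ Set.Icc 0 u, ∀ y ∈ Set.Icc 0 u, ∀ i, y i < x i → ∀ k : Option N,
      (∀ j, k = some j → x j < y j) → x - unitVec (some i) + unitVec k ∈ Set.Icc 0 u ∧
      y + unitVec (some i) - unitVec k ∈ Set.Icc 0 u := by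
    intro x hx y hy i hi k hk
    refine ⟨⟨fun j => ?_, fun j => ?_⟩, ⟨fun j => ?_, fun j => ?_⟩⟩ <;>
    · have h1 := hx.1 j
      have h2 := hx.2 j
      have h3 := hy.1 j
      have h4 := hy.2 j
      have h5 := hk j
      simp only [Pi.add_apply, Pi.sub_apply, Pi.zero_apply, unitVec, Option.some.injEq] at *
      split_ifs with c1 c2 c2 <;> (try subst c1) <;> (try have h6 := h5 c2) <;> omega
  intro x hx y hy i hi
  rcases h x hx y hy i (by simpa using hi) with h1 | ⟨j, hj, h1⟩
  · have hk : ∀ j, (none : Option N) = some j → x j < y j := by simp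
    obtain ⟨b1, b2⟩ := box x hx y hy i hi none hk
    exact ⟨none, hk, b1, b2, by simpa [chi_singleton] using h1⟩
  · have hk : ∀ j', some j = some j' → x j' < y j' := by
      rintro _ ⟨⟩; simpa using hj
    obtain ⟨b1, b2⟩ := box x hx y hy i hi (some j) hk
    exact ⟨some j, hk, b1, b2, by simpa [chi_singleton] using h1⟩

variable [Fintype N]

/-- The `ℓ¹` distance, the measure on which inductions by exchange run. -/
def l1Dist (x y : N → ℤ) : ℕ := ∑ i, (x i - y i).natAbs

theorem l1Dist_exchange_lt {x y : N → ℤ} {i : N} {k : Option N} (hi : x i < y i)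
    (hk : ∀ j, k = some j → y j < x j) :
    l1Dist (x + unitVec (some i) - unitVec k) y < l1Dist x y := by
  refine Finset.sum_lt_sum (fun j _ => ?_) ⟨i, Finset.mem_univ i, ?_⟩
  · have := hk j
    simp only [Pi.add_apply, Pi.sub_apply, unitVec, Option.some.injEq]
    split_ifs with c1 c2 c2 <;> (try subst c1) <;> (try have h6 := this c2) <;> omega
  · have := hk i
    simp only [Pi.add_apply, Pi.sub_apply, unitVec, if_true]
    split_ifs with c2 <;> (try have h6 := this c2) <;> omega

/-- A maximizer `y` of `w` that minimizes `y(X)` among the maximizers also maximizes `w(x) - x(X)`.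
Integrality of `w` enters: leaving the set of maximizers costs at least one. -/
theorem MNatConcaveOn.sub_sum_le {B : Set (N → ℤ)} {w : (N → ℤ) → ℤ} (h : MNatConcaveOn B w)
    {y : N → ℤ} (hy : y ∈ B) (hmax : ∀ z ∈ B, w z ≤ w y) {X : Finset N}
    (hmin : ∀ z ∈ B, w z = w y → ∑ i ∈ X, y i ≤ ∑ i ∈ X, z i) :
    ∀ x ∈ B, w x - ∑ i ∈ X, x i ≤ w y - ∑ i ∈ X, y i := by
  intro x
  induction hn : l1Dist x y using Nat.strong_induction_on generalizing x with
  | _ n ih =>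
  intro hx
  by_contra! hlt
  have h0 := hmax x hx
  obtain ⟨i, hiX, hi⟩ := Finset.exists_lt_of_sum_lt (s := X) (f := x) (g := y) (by linarith)
  obtain ⟨k, hk, h1, h2, h3⟩ := h y hy x hx i hi
  have h4 := ih _ (hn ▸ l1Dist_exchange_lt hi hk) _ rfl h2
  have h5 := hmax _ h1
  have h6 := hmin _ h1
  obtain ⟨c0, c1⟩ := sum_unitVec_mem k X
  simp only [Pi.add_apply, Pi.sub_apply, Finset.sum_add_distrib, Finset.sum_sub_distrib,
    sum_unitVec_of_mem hiX] at h4 h6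
  by_cases hw : w (y - unitVec (some i) + unitVec k) = w y
  · have := h6 hw; linarith
  · have : w (y - unitVec (some i) + unitVec k) < w y := lt_of_le_of_ne h5 hw
    linarith

/-- Local optimality for `x(R)` over an `M♮`-convex set: if `x(R)` is not minimal, then a single
exchange moves a unit out of `R`. -/
theorem IsMNatConvexSet.exists_exchange_of_sum_lt {D : Set (N → ℤ)} (h : IsMNatConvexSet D)
    {x : N → ℤ} (hx : x ∈ D) {R : Finset N} :
    ∀ y ∈ D, ∑ i ∈ R, y i < ∑ i ∈ R, x i →
      ∃ i ∈ R, ∃ k : Option N, (∀ j, k = some j → j ∉ R) ∧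
        x - unitVec (some i) + unitVec k ∈ D := by
  intro y
  induction hn : l1Dist y x using Nat.strong_induction_on generalizing y with
  | _ n ih =>
  intro hy hlt
  obtain ⟨i, hiR, hi⟩ := Finset.exists_lt_of_sum_lt hlt
  obtain ⟨k, hk, h1, h2⟩ := h x hx y hy i hi
  by_cases hkR : ∀ j, k = some j → j ∉ R
  · exact ⟨i, hiR, k, hkR, h1⟩
  · push Not at hkR
    obtain ⟨j, rfl, hj⟩ := hkR
    refine ih _ (hn ▸ l1Dist_exchange_lt hi hk) _ rfl h2 ?_
    simpa [Finset.sum_add_distrib, Finset.sum_sub_distrib, sum_unitVec_of_mem hiR,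
      sum_unitVec_of_mem hj] using hlt

end Exchange

/-! ### Successive exchanges -/

section Path

variable {N : Type*} [DecidableEq N] {D : Set (N → ℤ)}

/-- If units of `i` and of `k` cannot be given up singly, then neither can a unit of `k` after the
exchange `i → j`. -/
theorem IsMNatConvexSet.sub_add_sub_notMem (h : IsMNatConvexSet D) {x : N → ℤ} (hx : x ∈ D)
    {i j k : N} (hik : i ≠ k) (hi : x - unitVec (some i) ∉ D) (hk : x - unitVec (some k) ∉ D) :
    x - unitVec (some i) + unitVec (some j) - unitVec (some k) ∉ D := by
  intro hW
  by_cases hjk : j = k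
  · subst hjk; exact hi (by simpa using hW)
  by_cases hji : j = i
  · subst hji; exact hk (by simpa using hW)
  obtain ⟨m, hm, h1, h2⟩ := h x hx _ hW k (by simp [unitVec, hik, hjk])
  cases m with
  | none => exact hk (by simpa using h1)
  | some m =>
    have hmj : m = j := by
      by_contra hne
      have := hm m rfl
      simp only [Pi.add_apply, Pi.sub_apply, unitVec, Option.some.injEq] at this
      split_ifs at this <;> first | omega | (subst_vars; simp_all)
    subst hmj
    exact hi (by convert h2 using 1; abel)

/-- An exchange `k → l` survives the exchange `i → j` if `i → l` is not an exchange. -/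
theorem IsMNatConvexSet.exchange_persists (h : IsMNatConvexSet D) {x : N → ℤ} (hx : x ∈ D)
    {i j k : N} {l : Option N} (hij : x - unitVec (some i) + unitVec (some j) ∈ D)
    (hkl : x - unitVec (some k) + unitVec l ∈ D) (hil : x - unitVec (some i) + unitVec l ∉ D)
    (hi : x - unitVec (some i) ∉ D) (hk : l ≠ none → x - unitVec (some k) ∉ D) (hik : i ≠ k)
    (hlk : l ≠ some k) :
    x - unitVec (some i) + unitVec (some j) - unitVec (some k) + unitVec l ∈ D := by
  obtain ⟨m, hm, h1, h2⟩ := h _ hij _ hkl k (by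
    simp only [Pi.add_apply, Pi.sub_apply, unitVec, Option.some.injEq, hik, hlk, if_true, if_false]
    split_ifs <;> omega)
  by_cases hml : m = l
  · subst hml; exact h1
  exfalso
  cases m with
  | none =>
    exact h.sub_add_sub_notMem hx hik hi (hk (Ne.symm hml)) (by simpa using h1)
  | some m =>
    have hmi : m = i := by
      by_contra hne
      have := hm m rfl
      simp only [Pi.add_apply, Pi.sub_apply, unitVec, Option.some.injEq, Ne.symm hne,
        Ne.symm hml, if_false] at this
      split_ifs at this <;> omega
    subst hmi
    exact hil (by convert h2 using 1; abel)

/-- If neither `i → l` nor `k → l` is an exchange, then `k → l` does not become one after the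
exchange `i → j`. -/
theorem IsMNatConvexSet.not_exchange_persists (h : IsMNatConvexSet D) {x : N → ℤ} (hx : x ∈ D)
    {i j k : N} {l : Option N} (hil : x - unitVec (some i) + unitVec l ∉ D)
    (hkl : x - unitVec (some k) + unitVec l ∉ D) (hi : x - unitVec (some i) ∉ D)
    (hk : x - unitVec (some k) ∉ D) (hik : i ≠ k) :
    x - unitVec (some i) + unitVec (some j) - unitVec (some k) + unitVec l ∉ D := by
  intro hy
  cases l with
  | none => exact h.sub_add_sub_notMem hx hik hi hk (by simpa using hy)
  | some l =>
    have hli : i ≠ l := by rintro rfl; exact hil (by simpa using hx)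
    have hlk : k ≠ l := by rintro rfl; exact hkl (by simpa using hx)
    obtain ⟨m, hm, h1, h2⟩ := h _ hy _ hx l (by
      simp only [Pi.add_apply, Pi.sub_apply, unitVec, Option.some.injEq, hli, hlk, if_true,
        if_false]
      split_ifs <;> omega)
    cases m with
    | none => exact h.sub_add_sub_notMem hx hik hi hk (by simpa using h1)
    | some m =>
      by_cases hmi : m = i
      · subst hmi; exact hil (by convert h2 using 1; abel)
      by_cases hmk : m = k
      · subst hmk; exact hkl (by convert h2 using 1; abel)
      have := hm m rfl
      simp only [Pi.add_apply, Pi.sub_apply, unitVec, Option.some.injEq, Ne.symm hmi, Ne.symm hmk,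
        if_false] at this
      split_ifs at this <;> omega

end Path

/-! ### Augmentation in the exchange graph and Minkowski sums -/

section Sum

variable {M N : Type*} [DecidableEq N]

/-- The arcs of the exchange graph at `x`: in some `D b`, a unit of `i` may be exchanged for one
of `k`. -/
def ExchangeArc (D : M → Set (N → ℤ)) (x : M → N → ℤ) (i k : Option N) : Prop :=
  ∃ b, x b - unitVec i + unitVec k ∈ D b

/-- Exchanges along a chordless path in the exchange graph may be carried out one after the
other. The element `0` occurs at most as the end of the path, and only the last element before it
has an arc to it. -/
theorem exists_sum_eq_of_chordless [Fintype M] {D : M → Set (N → ℤ)}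
    (hD : ∀ b, IsMNatConvexSet (D b)) (n : ℕ) :
    ∀ (f : ℕ → Option N) (x : M → N → ℤ), (∀ b, x b ∈ D b) → (∀ r < n, f r ≠ none) →
      (∀ r < n, ExchangeArc D x (f r) (f (r + 1))) → (∀ r < n, f r ≠ f (r + 1)) →
      (∀ r s, r + 1 < s → s ≤ n → ¬ ExchangeArc D x (f r) (f s)) →
      (∀ r < n, f (r + 1) ≠ none → ¬ ExchangeArc D x (f r) none) →
      ∃ x' : M → N → ℤ, (∀ b, x' b ∈ D b) ∧
        ∑ b, x' b = ∑ b, x b - unitVec (f 0) + unitVec (f n) := by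
  classical
  induction n with
  | zero => intro f x hx _ _ _ _ _; exact ⟨x, hx, by simp⟩
  | succ n ih =>
  intro f x hx hnone harc hne hchord hzero
  obtain ⟨b₁, hb₁⟩ := harc 0 (by omega)
  obtain ⟨i, hi⟩ := Option.ne_none_iff_exists'.1 (hnone 0 (by omega))
  set x₁ := Function.update x b₁ (x b₁ - unitVec (f 0) + unitVec (f (0 + 1))) with hx₁
  have hx₁D : ∀ b, x₁ b ∈ D b := by
    intro b
    by_cases hb : b = b₁
    · subst hb; simpa [hx₁] using hb₁
    · simpa [hx₁, hb] using hx b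
  have hdist : ∀ r < n, f (r + 1) ≠ f 0 := by
    intro r hr h
    rcases Nat.eq_zero_or_pos r with rfl | hpos
    · exact hne 0 (by omega) h.symm
    · exact hchord 0 (r + 1) (by omega) (by omega) ⟨b₁, by simpa [h] using hx b₁⟩
  have not_mem : ∀ {a c : Option N} (b : M), ¬ ExchangeArc D x a c →
      x b - unitVec a + unitVec c ∉ D b := fun b h hb => h ⟨b, hb⟩
  -- No chord of the remaining path appears, not even one to the element `0`.
  have hnew : ∀ r < n, ∀ c, ¬ ExchangeArc D x (f 0) c → ¬ ExchangeArc D x (f (r + 1)) c →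
      ¬ ExchangeArc D x (f (r + 1)) none → ¬ ExchangeArc D x₁ (f (r + 1)) c := by
    rintro r hr c h0 h1 h2 ⟨b, hb⟩
    by_cases hbb : b = b₁
    · subst hbb
      obtain ⟨j, hj⟩ := Option.ne_none_iff_exists'.1 (hnone 1 (by omega))
      obtain ⟨k, hk⟩ := Option.ne_none_iff_exists'.1 (hnone (r + 1) (by omega))
      have hik : i ≠ k := by rintro rfl; exact hdist r hr (hk.trans hi.symm)
      have hz := hzero 0 (by omega) (by simp [hj])
      rw [hk] at h1 h2 hb
      rw [hi] at h0 hz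
      refine (hD b).not_exchange_persists (hx b) (j := j) (not_mem b h0) (not_mem b h1)
        (by simpa using not_mem b hz) (by simpa using not_mem b h2) hik ?_
      simpa [hx₁, hi, hj] using hb
    · exact h1 ⟨b, by simpa [hx₁, hbb] using hb⟩
  obtain ⟨x', hx', hsum⟩ := ih (fun r => f (r + 1)) x₁ hx₁D (fun r hr => hnone _ (by omega))
    (by
      intro r hr
      obtain ⟨b, hb⟩ := harc (r + 1) (by omega)
      refine ⟨b, ?_⟩
      by_cases hbb : b = b₁
      · subst hbb
        obtain ⟨j, hj⟩ := Option.ne_none_iff_exists'.1 (hnone 1 (by omega))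
        obtain ⟨k, hk⟩ := Option.ne_none_iff_exists'.1 (hnone (r + 1) (by omega))
        have hik : i ≠ k := by rintro rfl; exact hdist r hr (hk.trans hi.symm)
        have hz := hzero 0 (by omega) (by simp [hj])
        have hc := hchord 0 (r + 1 + 1) (by omega) (by omega)
        have hl := hne (r + 1) (by omega)
        have hkz := hzero (r + 1) (by omega)
        rw [hk] at hb hl hkz
        rw [hi] at hz hc hb₁
        have := (hD b).exchange_persists (hx b) (j := j) (by simpa [hj] using hb₁) hb
          (not_mem b hc) (by simpa using not_mem b hz)
          (fun h => by simpa using not_mem b (hkz h)) hik hl.symm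
        simpa [hx₁, hi, hj, hk] using this
      · simpa [hx₁, hbb] using hb)
    (fun r hr => hne _ (by omega))
    (fun r s hrs hs => hnew r (by omega) _ (hchord _ _ (by omega) (by omega))
      (hchord _ _ (by omega) (by omega))
      (hzero _ (by omega) (hnone (r + 1 + 1) (by omega))))
    (fun r hr h => hnew r hr _ (hzero 0 (by omega) (hnone 1 (by omega)))
      (hzero _ (by omega) h) (hzero _ (by omega) h))
  refine ⟨x', hx', hsum.trans ?_⟩
  have : ∑ b, x₁ b = ∑ b, x b - unitVec (f 0) + unitVec (f (0 + 1)) := by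
    rw [hx₁, Finset.sum_update_of_mem (Finset.mem_univ _),
      ← Finset.add_sum_erase Finset.univ x (Finset.mem_univ b₁), Finset.sdiff_singleton_eq_erase]
    abel
  rw [this]
  simp

/-- There is a walk of length `n` from `a` to `c` in the exchange graph at `x`. -/
def ExchangeWalk (D : M → Set (N → ℤ)) (x : M → N → ℤ) (n : ℕ) (a c : Option N) : Prop :=
  ∃ f : ℕ → Option N, f 0 = a ∧ f n = c ∧ ∀ r < n, ExchangeArc D x (f r) (f (r + 1))

theorem ExchangeWalk.trans {D : M → Set (N → ℤ)} {x : M → N → ℤ} {m n : ℕ} {a b c : Option N}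
    (h₁ : ExchangeWalk D x m a b) (h₂ : ExchangeWalk D x n b c) :
    ExchangeWalk D x (m + n) a c := by
  obtain ⟨f, hf0, hfm, hf⟩ := h₁
  obtain ⟨g, hg0, hgn, hg⟩ := h₂
  refine ⟨fun r => if r ≤ m then f r else g (r - m), by simpa using hf0, ?_, fun r hr => ?_⟩
  · by_cases hn : n = 0
    · subst hn; simp [hfm, ← hg0, hgn]
    · simpa [hn] using hgn
  · rcases lt_trichotomy r m with h | rfl | h
    · simpa [h.le, Nat.succ_le_of_lt h] using hf r h
    · simpa [hfm, ← hg0] using hg 0 (by omega)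
    · have e : r + 1 - m = r - m + 1 := by omega
      simpa [h.not_ge, show ¬ r + 1 ≤ m by omega, e] using hg (r - m) (by omega)

theorem ExchangeArc.walk {D : M → Set (N → ℤ)} {x : M → N → ℤ} {a c : Option N}
    (h : ExchangeArc D x a c) : ExchangeWalk D x 1 a c :=
  ⟨fun r => if r = 0 then a else c, by simp, by simp, fun r hr => by
    obtain rfl : r = 0 := by omega
    simpa using h⟩

theorem ExchangeWalk.of_path {D : M → Set (N → ℤ)} {x : M → N → ℤ} {f : ℕ → Option N} {n : ℕ}
    (hf : ∀ r < n, ExchangeArc D x (f r) (f (r + 1))) {r s : ℕ} (hrs : r ≤ s) (hs : s ≤ n) :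
    ExchangeWalk D x (s - r) (f r) (f s) :=
  ⟨fun q => f (r + q), by simp, by simp [hrs], fun q hq => hf (r + q) (by omega)⟩

/-- If `c` is reachable from `a` in the exchange graph, then a unit of `a` in `∑ b, x b` may be
exchanged for one of `c`. The element `0` must not be reachable otherwise, since it is no
admissible inner vertex of a path. -/
theorem exists_sum_eq_of_walk [Fintype M] {D : M → Set (N → ℤ)}
    (hD : ∀ b, IsMNatConvexSet (D b)) {x : M → N → ℤ} (hx : ∀ b, x b ∈ D b) {a c : Option N}
    (hac : ∃ n, ExchangeWalk D x n a c) (hc : c = none ∨ ¬ ∃ n, ExchangeWalk D x n a none) :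
    ∃ x' : M → N → ℤ, (∀ b, x' b ∈ D b) ∧
      ∑ b, x' b = ∑ b, x b - unitVec a + unitVec c := by
  classical
  -- A shortest walk is a chordless path.
  obtain ⟨f, hf0, hfn, hf⟩ := Nat.find_spec hac
  set n := Nat.find hac
  have hmin : ∀ {m}, ExchangeWalk D x m a c → n ≤ m := fun h => Nat.find_min' hac h
  have hpre : ∀ r ≤ n, ExchangeWalk D x r a (f r) := fun r hr => by
    simpa [hf0] using ExchangeWalk.of_path hf (Nat.zero_le r) hr
  have hpost : ∀ s ≤ n, ExchangeWalk D x (n - s) (f s) c := fun s hs => by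
    simpa [hfn] using ExchangeWalk.of_path hf hs le_rfl
  have hchord : ∀ r s, r + 1 < s → s ≤ n → ¬ ExchangeArc D x (f r) (f s) := by
    intro r s hrs hs h
    have := hmin (((hpre r (by omega)).trans h.walk).trans (hpost s hs))
    omega
  have hne : ∀ r < n, f r ≠ f (r + 1) := by
    intro r hr h
    have := hmin ((hpre r hr.le).trans (h ▸ hpost (r + 1) hr))
    omega
  have hnone : ∀ r < n, f r ≠ none := by
    intro r hr h
    rcases hc with rfl | hc
    · have := hmin (h ▸ hpre r hr.le)
      omega
    · exact hc ⟨r, h ▸ hpre r hr.le⟩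
  have hzero : ∀ r < n, f (r + 1) ≠ none → ¬ ExchangeArc D x (f r) none := by
    intro r hr h harc
    rcases hc with rfl | hc
    · have := hmin ((hpre r hr.le).trans harc.walk)
      have e : r + 1 = n := by omega
      exact h (e ▸ hfn)
    · exact hc ⟨_, (hpre r hr.le).trans harc.walk⟩
  simpa [hf0, hfn] using exists_sum_eq_of_chordless hD n f x hx hnone hf hne hchord hzero

variable [Fintype M] [Fintype N]

/-- As long as `∑ b, x b` exceeds `u` somewhere, an augmentation in the exchange graph brings it
closer to `u`: otherwise the vertices reachable from the excess form a set `R` on which every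
`x b` is minimal, although the sum exceeds `u(R)`. -/
theorem exists_l1Dist_sum_lt {D : M → Set (N → ℤ)} (hD : ∀ b, IsMNatConvexSet (D b))
    {u : N → ℤ} (hle : ∀ (R : Finset N) (x : M → N → ℤ), (∀ b, x b ∈ D b) →
      (∀ b, ∀ y ∈ D b, ∑ i ∈ R, x b i ≤ ∑ i ∈ R, y i) → ∑ b, ∑ i ∈ R, x b i ≤ ∑ i ∈ R, u i)
    {x : M → N → ℤ} (hx : ∀ b, x b ∈ D b) {t : N} (ht : u t < (∑ b, x b) t) :
    ∃ x' : M → N → ℤ, (∀ b, x' b ∈ D b) ∧ l1Dist (∑ b, x' b) u < l1Dist (∑ b, x b) u := by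
  classical
  have key : ∀ c : Option N, (∀ j, c = some j → (∑ b, x b) j < u j) →
      l1Dist (∑ b, x b - unitVec (some t) + unitVec c) u < l1Dist (∑ b, x b) u := by
    intro c hc
    refine Finset.sum_lt_sum (fun j _ => ?_) ⟨t, Finset.mem_univ t, ?_⟩
    · have := hc j
      simp only [Pi.add_apply, Pi.sub_apply, unitVec, Option.some.injEq]
      split_ifs with c1 c2 c2 <;> (try subst c1) <;> (try have h6 := this c2) <;> omega
    · have := hc t
      simp only [Pi.add_apply, Pi.sub_apply, unitVec, if_true]
      split_ifs with c2 <;> (try have h6 := this c2) <;> omega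
  by_cases h0 : ∃ n, ExchangeWalk D x n (some t) none
  · obtain ⟨x', hx', hs⟩ := exists_sum_eq_of_walk hD hx h0 (Or.inl rfl)
    exact ⟨x', hx', hs ▸ key none (by simp)⟩
  by_cases h1 : ∃ s, (∑ b, x b) s < u s ∧ ∃ n, ExchangeWalk D x n (some t) (some s)
  · obtain ⟨s, hs, hw⟩ := h1
    obtain ⟨x', hx', hsum⟩ := exists_sum_eq_of_walk hD hx hw (Or.inr h0)
    exact ⟨x', hx', hsum ▸ key (some s) (by rintro _ ⟨⟩; exact hs)⟩
  exfalso
  set R : Finset N := {i | ∃ n, ExchangeWalk D x n (some t) (some i)} with hR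
  have htR : t ∈ R := by
    simp only [hR, Finset.mem_filter, Finset.mem_univ, true_and]
    exact ⟨0, fun _ => some t, rfl, rfl, by simp⟩
  have hlow := hle R x hx fun b y hy => by
    by_contra! hlt
    obtain ⟨i, hi, k, hk, hmem⟩ := (hD b).exists_exchange_of_sum_lt (hx b) y hy hlt
    simp only [hR, Finset.mem_filter, Finset.mem_univ, true_and] at hi hk
    obtain ⟨n, hn⟩ := hi
    have hw := hn.trans (ExchangeArc.walk ⟨b, hmem⟩)
    cases k with
    | none => exact h0 ⟨_, hw⟩
    | some k => exact hk k rfl ⟨_, hw⟩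
  have hgt : ∑ i ∈ R, u i < ∑ i ∈ R, (∑ b, x b) i := by
    refine Finset.sum_lt_sum (fun i hi => ?_) ⟨t, htR, ht⟩
    by_contra! hlt
    simp only [hR, Finset.mem_filter, Finset.mem_univ, true_and] at hi
    exact h1 ⟨i, hlt, hi⟩
  simp only [Finset.sum_apply] at hgt
  rw [Finset.sum_comm] at hgt
  linarith

/-- The Minkowski sum of `M♮`-convex sets contains every integer vector that obeys the linear
inequalities valid for the sum on sets of coordinates. -/
theorem exists_sum_eq_of_isMNatConvexSet {D : M → Set (N → ℤ)}
    (hD : ∀ b, IsMNatConvexSet (D b)) (hne : ∀ b, (D b).Nonempty) {u : N → ℤ}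
    (hle : ∀ (R : Finset N) (x : M → N → ℤ), (∀ b, x b ∈ D b) →
      (∀ b, ∀ y ∈ D b, ∑ i ∈ R, x b i ≤ ∑ i ∈ R, y i) → ∑ b, ∑ i ∈ R, x b i ≤ ∑ i ∈ R, u i)
    (hge : ∀ (R : Finset N) (x : M → N → ℤ), (∀ b, x b ∈ D b) →
      (∀ b, ∀ y ∈ D b, ∑ i ∈ R, y i ≤ ∑ i ∈ R, x b i) → ∑ i ∈ R, u i ≤ ∑ b, ∑ i ∈ R, x b i) :
    ∃ x : M → N → ℤ, (∀ b, x b ∈ D b) ∧ ∑ b, x b = u := by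
  classical
  have hex : ∃ n, ∃ x : M → N → ℤ, (∀ b, x b ∈ D b) ∧ l1Dist (∑ b, x b) u = n :=
    ⟨_, fun b => (hne b).some, fun b => (hne b).some_mem, rfl⟩
  obtain ⟨x, hx, hdist⟩ := Nat.find_spec hex
  have hmin : ∀ x' : M → N → ℤ, (∀ b, x' b ∈ D b) →
      l1Dist (∑ b, x b) u ≤ l1Dist (∑ b, x' b) u :=
    fun x' hx' => hdist ▸ Nat.find_min' hex ⟨x', hx', rfl⟩
  refine ⟨x, hx, funext fun t => ?_⟩
  rcases lt_trichotomy ((∑ b, x b) t) (u t) with ht | ht | ht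
  · -- A deficit is an excess of the reflected sets `-D b` over `-u`.
    exfalso
    obtain ⟨x', hx', hlt⟩ := exists_l1Dist_sum_lt (D := fun b => {y | -y ∈ D b}) (u := -u)
      (x := fun b => -x b) (t := t) (fun b => (hD b).neg)
      (fun R z hz hzmin => by
        have := hge R (fun b => -z b) hz fun b y hy => by
          have := hzmin b (-y) (by simpa using hy)
          simp only [Pi.neg_apply, Finset.sum_neg_distrib] at this ⊢
          linarith
        simp only [Pi.neg_apply, Finset.sum_neg_distrib] at this ⊢
        linarith)
      (fun b => by simpa using hx b) (by simpa [Finset.sum_apply] using ht)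
    have e : ∀ y z : N → ℤ, l1Dist (-y) (-z) = l1Dist y z := fun y z =>
      Finset.sum_congr rfl fun i _ => by simp only [Pi.neg_apply]; omega
    have := hmin (fun b => -x' b) hx'
    have e' := e (∑ b, x' b) (-u)
    rw [neg_neg] at e'
    rw [Finset.sum_neg_distrib, e] at hlt
    rw [Finset.sum_neg_distrib] at this
    omega
  · exact ht
  · obtain ⟨x', hx', hlt⟩ := exists_l1Dist_sum_lt hD hle hx ht
    exact absurd (hmin x' hx') (by omega)

end Sum

/-! ### Submodularity from unit squares -/

/-- Layer decomposition: a nonnegative integer vector is the sum of the characteristic vectors of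
its level sets. -/
theorem dotProduct_eq_sum_layers {N : Type*} [Fintype N] {c : N → ℤ} (hc : 0 ≤ c) {K : ℕ}
    (hK : ∀ i, c i ≤ K) (z : N → ℤ) : c ⬝ᵥ z = ∑ k ∈ Finset.range K, ∑ i with (k : ℤ) < c i, z i := by
  simp only [Finset.sum_filter]
  rw [Finset.sum_comm]
  refine Finset.sum_congr rfl fun i _ => ?_
  rw [← Finset.sum_filter, Finset.sum_const]
  have hci := hc i
  have : (Finset.range K).filter (fun k : ℕ => (k : ℤ) < c i) = Finset.range (c i).toNat := by
    ext k
    have := hK i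
    simp only [Finset.mem_filter, Finset.mem_range]
    omega
  rw [this, Finset.card_range, nsmul_eq_mul, Int.natCast_toNat_eq_self.2 hci]

section Submodular

variable {N : Type*} [Fintype N] [DecidableEq N]

theorem nonneg_vector_induction {P : (N → ℤ) → Prop} (zero : P 0)
    (add : ∀ b, 0 ≤ b → ∀ i, P b → P (b + unitVec (some i))) : ∀ b, 0 ≤ b → P b := by
  intro b
  induction hn : ∑ i, (b i).toNat using Nat.strong_induction_on generalizing b with
  | _ n ih =>
  intro hb
  by_cases h0 : b = 0
  · exact h0 ▸ zero
  obtain ⟨i, hi⟩ := Function.ne_iff.1 h0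
  have hi' : 0 < b i := lt_of_le_of_ne (hb i) (Ne.symm hi)
  have hb' : 0 ≤ b - unitVec (some i) := by
    intro j
    have := hb j
    simp only [Pi.zero_apply, Pi.sub_apply, unitVec, Option.some.injEq] at *
    split_ifs with c
    · subst c; omega
    · omega
  have hlt : ∑ j, ((b - unitVec (some i)) j).toNat < n := by
    rw [← hn]
    refine Finset.sum_lt_sum (fun j _ => ?_) ⟨i, Finset.mem_univ i, ?_⟩
    · simp only [Pi.sub_apply, unitVec]; split_ifs <;> omega
    · simp only [Pi.sub_apply, unitVec, if_true]; omega
  simpa using add _ hb' i (ih _ hlt _ rfl hb')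

/-- A function of integer vectors is submodular if it is so on unit squares. -/
theorem submodular_of_unit_squares {g : (N → ℤ) → ℤ}
    (h : ∀ p i j, i ≠ j → g (p + unitVec (some i) + unitVec (some j)) + g p ≤
      g (p + unitVec (some i)) + g (p + unitVec (some j))) (p q : N → ℤ) :
    g (p ⊔ q) + g (p ⊓ q) ≤ g p + g q := by
  -- Unit squares stack up to strips of width one, and these to boxes.
  have strip : ∀ i, ∀ b, 0 ≤ b → ∀ d : N → ℤ, b i = 0 →
      g (d + unitVec (some i) + b) + g d ≤ g (d + unitVec (some i)) + g (d + b) := by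
    intro i b hb
    refine nonneg_vector_induction (P := fun b => ∀ d : N → ℤ, b i = 0 →
      g (d + unitVec (some i) + b) + g d ≤ g (d + unitVec (some i)) + g (d + b)) ?_ ?_ b hb
    · intro d _; simp
    · intro b hb j ih d hbi
      have hbi0 := hb i
      have hij : i ≠ j := by
        rintro rfl
        simp only [Pi.add_apply, Pi.zero_apply, unitVec, if_true] at hbi hbi0
        omega
      have h1 := ih d (by simpa [unitVec, Ne.symm hij] using hbi)
      have h2 := h (d + b) i j hij
      have e1 : d + b + unitVec (some i) + unitVec (some j) =
        d + unitVec (some i) + (b + unitVec (some j)) := by abel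
      have e2 : d + b + unitVec (some i) = d + unitVec (some i) + b := by abel
      rw [e1, e2, add_assoc d b] at h2
      linarith
  have box : ∀ b, 0 ≤ b → ∀ d a, 0 ≤ a → (∀ i, a i = 0 ∨ b i = 0) →
      g (d + a + b) + g d ≤ g (d + a) + g (d + b) := by
    intro b hb d a ha
    refine nonneg_vector_induction (P := fun a => (∀ i, a i = 0 ∨ b i = 0) →
      g (d + a + b) + g d ≤ g (d + a) + g (d + b)) ?_ ?_ a ha
    · intro _; simp [add_comm]
    · intro a ha i ih hab
      have hai := ha i
      have hbi : b i = 0 := (hab i).resolve_left (by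
        simp only [Pi.add_apply, Pi.zero_apply, unitVec, if_true] at hai ⊢
        omega)
      have h1 := ih fun j => by
        have haj := ha j
        refine (hab j).imp_left fun h => ?_
        simp only [Pi.add_apply, Pi.zero_apply, unitVec] at h haj
        split_ifs at h <;> omega
      have h2 := strip i b hb (d + a) hbi
      rw [← add_assoc d a]
      linarith
  have := box (q - p ⊓ q) (sub_nonneg.2 inf_le_right) (p ⊓ q) (p - p ⊓ q)
    (sub_nonneg.2 inf_le_left) fun i => by
      simp only [Pi.sub_apply, Pi.inf_apply]
      omega
  have e : p ⊓ q + (p - p ⊓ q) + (q - p ⊓ q) = p ⊔ q := by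
    ext i
    simp only [Pi.add_apply, Pi.sub_apply, Pi.inf_apply, Pi.sup_apply]
    omega
  rw [e, add_sub_cancel, add_sub_cancel] at this
  exact this

theorem chi_dotProduct (X : Finset N) (y : N → ℤ) : chi X ⬝ᵥ y = ∑ i ∈ X, y i := by
  simp [dotProduct, chi]

end Submodular

/-! ### Demand sets and indirect utility -/

namespace MultiDemandModel

variable {M N : Type*} [Fintype N] [DecidableEq N] (A : MultiDemandModel M N)

/-- The indirect utility `V_b(p) = max {v_b(x) - pᵀ x | x ∈ [0, u]}`. -/
noncomputable def indirectUtility (b : M) (p : N → ℤ) : ℤ :=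
  A.v b (A.demand_nonempty b p).some - p ⬝ᵥ (A.demand_nonempty b p).some

variable {A} {b : M} {p : N → ℤ}

theorem le_indirectUtility {y : N → ℤ} (hy : y ∈ Set.Icc 0 A.u) :
    A.v b y - p ⬝ᵥ y ≤ A.indirectUtility b p :=
  (A.demand_nonempty b p).some_mem.2 y hy

theorem indirectUtility_eq {y : N → ℤ} (hy : y ∈ A.demand b p) :
    A.indirectUtility b p = A.v b y - p ⬝ᵥ y :=
  le_antisymm (hy.2 _ (A.demand_nonempty b p).some_mem.1) (le_indirectUtility hy.1)

theorem mem_demand_iff {y : N → ℤ} : y ∈ A.demand b p ↔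
    y ∈ Set.Icc 0 A.u ∧ A.v b y - p ⬝ᵥ y = A.indirectUtility b p :=
  ⟨fun h => ⟨h.1, (indirectUtility_eq h).symm⟩,
    fun h => ⟨h.1, fun _ hz => (le_indirectUtility hz).trans_eq h.2.symm⟩⟩

theorem mu_le {y : N → ℤ} (X : Finset N) (hy : y ∈ A.demand b p) :
    A.mu b X p ≤ ∑ i ∈ X, y i :=
  (A.isLeast_mu b X p).2 ⟨y, hy, rfl⟩

theorem mu_empty (A : MultiDemandModel M N) (b : M) (p : N → ℤ) : A.mu b ∅ p = 0 := by
  obtain ⟨y, _, h⟩ := (A.isLeast_mu b ∅ p).1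
  simpa using h.symm

theorem isMNatConvexSet_demand (hA : MNatConcave A.u (A.v b)) (p : N → ℤ) :
    IsMNatConvexSet (A.demand b p) :=
  (hA.mNatConcaveOn.sub_linear p).argmax

theorem indirectUtility_add_chi (hA : MNatConcave A.u (A.v b)) (p : N → ℤ) (X : Finset N) :
    A.indirectUtility b (p + chi X) = A.indirectUtility b p - A.mu b X p := by
  obtain ⟨y, hy, hyX⟩ := (A.isLeast_mu b X p).1
  simp only at hyX
  rw [indirectUtility_eq hy, ← hyX]
  refine le_antisymm ?_ ?_
  · obtain ⟨x, hx⟩ := A.demand_nonempty b (p + chi X)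
    rw [indirectUtility_eq hx, add_dotProduct, chi_dotProduct]
    have := (hA.mNatConcaveOn.sub_linear p).sub_sum_le hy.1 hy.2 (X := X)
      (fun z hz hzy => hyX ▸ mu_le X (mem_demand_iff.2 ⟨hz,
        hzy.trans (indirectUtility_eq hy).symm⟩))
      x hx.1
    linarith
  · have := le_indirectUtility (b := b) (p := p + chi X) hy.1
    rw [add_dotProduct, chi_dotProduct] at this
    linarith

/-- The counterpart of `indirectUtility_add_chi` for a price decrease, by reflection of the box. -/
theorem indirectUtility_sub_chi_le (hA : MNatConcave A.u (A.v b)) {y : N → ℤ} {X : Finset N}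
    (hy : y ∈ A.demand b p) (hmax : ∀ z ∈ A.demand b p, ∑ i ∈ X, z i ≤ ∑ i ∈ X, y i) :
    A.indirectUtility b (p - chi X) ≤ A.indirectUtility b p + ∑ i ∈ X, y i := by
  obtain ⟨x, hx⟩ := A.demand_nonempty b (p - chi X)
  rw [indirectUtility_eq hx, indirectUtility_eq hy, sub_dotProduct, chi_dotProduct]
  have := (hA.mNatConcaveOn.sub_linear p).neg.sub_sum_le (X := X) (y := -y)
    (by simpa using hy.1) (fun z hz => by simpa using hy.2 _ hz)
    (fun z hz hzy => by
      have := hmax (-z) (mem_demand_iff.2 ⟨hz, by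
        rw [indirectUtility_eq hy]; simpa using hzy⟩)
      simp only [Pi.neg_apply, Finset.sum_neg_distrib] at this ⊢
      linarith) (-x) (by simpa using hx.1)
  simp only [neg_neg, Pi.neg_apply, Finset.sum_neg_distrib] at this
  linarith

/-- The formula for unit price increases reduces submodularity of the indirect utility to
`μ_b({i}) + μ_b({j}) ≤ μ_b({i, j})`. -/
theorem indirectUtility_submodular (hA : MNatConcave A.u (A.v b)) (p q : N → ℤ) :
    A.indirectUtility b (p ⊔ q) + A.indirectUtility b (p ⊓ q) ≤
      A.indirectUtility b p + A.indirectUtility b q := by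
  refine submodular_of_unit_squares (fun p i j hij => ?_) p q
  have e : p + unitVec (some i) + unitVec (some j) = p + chi {i, j} := by
    ext k
    simp only [Pi.add_apply, unitVec, chi, Option.some.injEq, Finset.mem_insert,
      Finset.mem_singleton]
    split_ifs <;> grind
  rw [e, ← chi_singleton, ← chi_singleton, indirectUtility_add_chi hA, indirectUtility_add_chi hA,
    indirectUtility_add_chi hA]
  obtain ⟨y, hy, hyX⟩ := (A.isLeast_mu b {i, j} p).1
  have h1 := mu_le {i} hy
  have h2 := mu_le {j} hy
  simp only [Finset.sum_pair hij, Finset.sum_singleton] at hyX h1 h2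
  linarith

/-- Among the demanded bundles, one that minimizes `cᵀ y` for a nonnegative `c` minimizes `y(X)`
simultaneously for all level sets `X` of `c`: an exchange that lowers `y(X)` moves a unit to an
element of smaller weight. -/
theorem exists_mem_demand_sum_eq_mu (hA : MNatConcave A.u (A.v b)) (p c : N → ℤ) :
    ∃ y ∈ A.demand b p, ∀ k : ℕ,
      ∑ i with (k : ℤ) < c i, y i = A.mu b {i | (k : ℤ) < c i} p := by
  have hfin : (A.demand b p).Finite := (Set.finite_Icc 0 A.u).subset fun y hy => hy.1
  obtain ⟨y, hy, hmin⟩ := Set.exists_min_image _ (fun y => c ⬝ᵥ y) hfin (A.demand_nonempty b p)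
  refine ⟨y, hy, fun k => le_antisymm ?_ (mu_le _ hy)⟩
  by_contra! hlt
  obtain ⟨z, hz, hzX⟩ := (A.isLeast_mu b {i | (k : ℤ) < c i} p).1
  rw [← hzX] at hlt
  obtain ⟨i, hi, l, hl, hmem⟩ :=
    (isMNatConvexSet_demand hA p).exists_exchange_of_sum_lt hy z hz hlt
  have hci : ∀ i, c ⬝ᵥ unitVec (some i) = c i := fun i => by simp [dotProduct, unitVec]
  have h := hmin _ hmem
  simp only [Finset.mem_filter, Finset.mem_univ, true_and] at hi hl
  rw [dotProduct_add, dotProduct_sub, hci] at h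
  cases l with
  | none =>
    rw [unitVec_none, dotProduct_zero] at h
    omega
  | some l =>
    have := hl l rfl
    rw [hci] at h
    omega

/-! ### The Lyapunov function -/

variable [Fintype M]

variable (A) in
/-- The Lyapunov function of the auction: the indirect utilities plus the price of the supply. -/
noncomputable def lyapunov (p : N → ℤ) : ℤ := ∑ b, A.indirectUtility b p + p ⬝ᵥ A.u

theorem lyapunov_nonneg (hp : 0 ≤ p) : 0 ≤ A.lyapunov p := by
  refine add_nonneg (Finset.sum_nonneg fun b _ => ?_)
    (Finset.sum_nonneg fun i _ => mul_nonneg (hp i) (A.u_pos i).le)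
  have := le_indirectUtility (A := A) (b := b) (p := p) (y := 0)
    ⟨le_rfl, fun i => (A.u_pos i).le⟩
  simpa [A.v_zero] using this

theorem lyapunov_add_chi (hA : ∀ b, MNatConcave A.u (A.v b)) (p : N → ℤ) (X : Finset N) :
    A.lyapunov (p + chi X) = A.lyapunov p + (∑ i ∈ X, A.u i - ∑ b, A.mu b X p) := by
  simp only [lyapunov, indirectUtility_add_chi (hA _), Finset.sum_sub_distrib, add_dotProduct,
    chi_dotProduct]
  ring

theorem lyapunov_submodular (hA : ∀ b, MNatConcave A.u (A.v b)) (p q : N → ℤ) :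
    A.lyapunov (p ⊔ q) + A.lyapunov (p ⊓ q) ≤ A.lyapunov p + A.lyapunov q := by
  have h := Finset.sum_le_sum fun b (_ : b ∈ Finset.univ) => indirectUtility_submodular (hA b) p q
  simp only [Finset.sum_add_distrib] at h
  have e : p ⊔ q + p ⊓ q = p + q := by
    ext i
    simp only [Pi.add_apply, Pi.sup_apply, Pi.inf_apply]
    omega
  have h2 : (p ⊔ q) ⬝ᵥ A.u + (p ⊓ q) ⬝ᵥ A.u = p ⬝ᵥ A.u + q ⬝ᵥ A.u := by
    rw [← add_dotProduct, ← add_dotProduct, e]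
  simp only [lyapunov]
  linarith

/-- Weak duality: at any prices, the Lyapunov function bounds the welfare of any allocation. -/
theorem sum_le_lyapunov {x : M → N → ℤ} (hx : A.IsAllocation x) (q : N → ℤ) :
    ∑ b, A.v b (x b) ≤ A.lyapunov q := by
  have h := Finset.sum_le_sum fun b (_ : b ∈ Finset.univ) =>
    le_indirectUtility (b := b) (p := q) (hx.1 b)
  rw [Finset.sum_sub_distrib, ← dotProduct_sum, hx.2] at h
  simp only [lyapunov]
  linarith

theorem IsEquilibriumPrice.lyapunov_le (h : A.IsEquilibriumPrice p) (q : N → ℤ) :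
    A.lyapunov p ≤ A.lyapunov q := by
  obtain ⟨_, x, hx, hxD⟩ := h
  refine le_trans (le_of_eq ?_) (sum_le_lyapunov hx q)
  simp only [lyapunov, indirectUtility_eq (hxD _), Finset.sum_sub_distrib]
  rw [← dotProduct_sum, hx.2]
  ring

/-- Negative prices do not help: at a negative price every bidder may as well take all units, so
raising it to zero decreases the indirect utility of each of the bidders, of which there is at
least one, by the amount by which the price of the supply increases. -/
theorem lyapunov_sup_zero_le [Nonempty M] (q : N → ℤ) : A.lyapunov (q ⊔ 0) ≤ A.lyapunov q := by
  have key : ∀ b, A.indirectUtility b (q ⊔ 0) + ((q ⊔ 0) ⬝ᵥ A.u - q ⬝ᵥ A.u) ≤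
      A.indirectUtility b q := by
    intro b
    obtain ⟨y, hy⟩ := A.demand_nonempty b (q ⊔ 0)
    set z : N → ℤ := fun i => if q i < 0 then A.u i else y i with hz
    have hyz : y ≤ z := fun i => by
      have := hy.1.2 i
      simp only [hz]
      split_ifs <;> simp [this]
    have hzB : z ∈ Set.Icc 0 A.u := by
      refine ⟨hy.1.1.trans hyz, fun i => ?_⟩
      have := hy.1.2 i
      simp only [hz]
      split_ifs <;> simp [this]
    have h1 := A.v_mono b hy.1 hzB hyz
    have h2 := le_indirectUtility (b := b) (p := q) hzB
    have h3 : q ⬝ᵥ z + ((q ⊔ 0) ⬝ᵥ A.u - q ⬝ᵥ A.u) = (q ⊔ 0) ⬝ᵥ y := by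
      simp only [dotProduct, ← Finset.sum_sub_distrib, ← Finset.sum_add_distrib]
      refine Finset.sum_congr rfl fun i _ => ?_
      simp only [hz, Pi.sup_apply, Pi.zero_apply]
      split_ifs with h
      · rw [sup_eq_right.2 h.le]; ring
      · rw [sup_eq_left.2 (not_lt.1 h)]; ring
    rw [indirectUtility_eq hy]
    linarith
  have hu : 0 ≤ (q ⊔ 0) ⬝ᵥ A.u - q ⬝ᵥ A.u := by
    rw [← sub_dotProduct]
    exact Finset.sum_nonneg fun i _ => mul_nonneg (sub_nonneg.2 le_sup_left) (A.u_pos i).le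
  have h := Finset.sum_le_sum fun b (_ : b ∈ Finset.univ) => key b
  rw [Finset.sum_add_distrib, Finset.sum_const, Finset.card_univ, nsmul_eq_mul] at h
  have hc : (1 : ℤ) ≤ Fintype.card M := by exact_mod_cast Fintype.card_pos
  have := le_mul_of_one_le_left hu hc
  simp only [lyapunov]
  linarith

/-- At a minimizer of the Lyapunov function, the inequalities required for `u` to lie in the sum of
the demand sets say that changing the prices on a set by one does not lower the function. -/
theorem isEquilibriumPrice_of_lyapunov_le [Nonempty M] (hA : ∀ b, MNatConcave A.u (A.v b))
    (hp : 0 ≤ p) (hmin : ∀ q, 0 ≤ q → A.lyapunov p ≤ A.lyapunov q) :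
    A.IsEquilibriumPrice p := by
  have hmin' : ∀ q, A.lyapunov p ≤ A.lyapunov q := fun q =>
    (hmin _ le_sup_right).trans (lyapunov_sup_zero_le q)
  obtain ⟨x, hx, hsum⟩ := exists_sum_eq_of_isMNatConvexSet (D := fun b => A.demand b p) (u := A.u)
    (fun b => isMNatConvexSet_demand (hA b) p) (fun b => A.demand_nonempty b p)
    (fun R x hx hxR => by
      have h := hmin' (p + chi R)
      rw [lyapunov_add_chi hA] at h
      have : ∀ b, A.mu b R p = ∑ i ∈ R, x b i := fun b => by
        obtain ⟨y, hy, hyR⟩ := (A.isLeast_mu b R p).1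
        exact le_antisymm (mu_le R (hx b)) (hyR ▸ hxR b y hy)
      simp only [this] at h
      linarith)
    (fun R x hx hxR => by
      -- `p - χ_R` may have negative entries.
      have h := hmin' (p - chi R)
      have h2 := Finset.sum_le_sum fun b (_ : b ∈ Finset.univ) =>
        indirectUtility_sub_chi_le (hA b) (hx b) (hxR b)
      rw [Finset.sum_add_distrib] at h2
      simp only [lyapunov, sub_dotProduct, chi_dotProduct] at h
      linarith)
  exact ⟨hp, x, ⟨fun b => (hx b).1, hsum⟩, hx⟩

/-! ### Iterations of the auction -/

/-- If no set is overdemanded at `p`, then `p` minimizes the Lyapunov function among all larger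
prices. -/
theorem Stops.lyapunov_le (hA : ∀ b, MNatConcave A.u (A.v b)) (h : A.Stops p) {q : N → ℤ}
    (hpq : p ≤ q) : A.lyapunov p ≤ A.lyapunov q := by
  have hc : 0 ≤ q - p := sub_nonneg.2 hpq
  choose y hy hyX using fun b => exists_mem_demand_sum_eq_mu (hA b) p (q - p)
  obtain ⟨K, hK⟩ : ∃ K : ℕ, ∀ i, (q - p) i ≤ K :=
    ⟨∑ i, ((q - p) i).toNat, fun i => (Int.self_le_toNat _).trans (by
      exact_mod_cast Finset.single_le_sum (f := fun i => ((q - p) i).toNat)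
        (fun _ _ => Nat.zero_le _) (Finset.mem_univ i))⟩
  have h1 : ∑ b, (q - p) ⬝ᵥ y b ≤ (q - p) ⬝ᵥ A.u := by
    simp only [dotProduct_eq_sum_layers hc hK, hyX]
    rw [Finset.sum_comm]
    exact Finset.sum_le_sum fun k _ => not_lt.1 (h _)
  have h2 := Finset.sum_le_sum fun b (_ : b ∈ Finset.univ) =>
    le_indirectUtility (b := b) (p := q) (hy b).1
  simp only [lyapunov, indirectUtility_eq (hy _), Finset.sum_sub_distrib, sub_dotProduct]
    at h1 h2 ⊢
  linarith

/-- As long as the auction does not stop, the rule can be obeyed: a smallest minimizer `X` of the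
increment `u(X) - ∑ b, μ_b(X; p)` of the Lyapunov function is an overdemanded excess-demand set. -/
theorem exists_isExcessDemand (h : ¬ A.Stops p) :
    ∃ X, A.IsOverdemanded p X ∧ A.IsExcessDemand p X := by
  set f : Finset N → ℤ := fun X => ∑ i ∈ X, A.u i - ∑ b, A.mu b X p with hf
  obtain ⟨X₀, -, hX₀⟩ := Finset.exists_min_image Finset.univ f Finset.univ_nonempty
  obtain ⟨X, hX, hcard⟩ := Finset.exists_min_image (Finset.univ.filter fun X => f X = f X₀)
    Finset.card ⟨X₀, by simp⟩
  simp only [Finset.mem_filter, Finset.mem_univ, true_and, forall_const] at hX hcard hX₀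
  have hover : A.IsOverdemanded p X := by
    simp only [Stops, not_forall, not_not] at h
    obtain ⟨Y, hY⟩ := h
    have := hX₀ Y
    rw [← hX] at this
    simp only [hf, IsOverdemanded] at *
    linarith
  refine ⟨X, hover, ?_, fun Z hZ hZne => ?_⟩
  · rw [Finset.nonempty_iff_ne_empty]
    rintro rfl
    simp [IsOverdemanded, mu_empty] at hover
  · have hlt : f X < f (X \ Z) := by
      refine lt_of_le_of_ne (hX ▸ hX₀ _) fun he => ?_
      have h1 := hcard (X \ Z) (he ▸ hX)
      have h2 : (X \ Z).card < X.card := Finset.card_lt_card (Finset.sdiff_ssubset hZ hZne)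
      omega
    have := Finset.sum_sdiff (f := A.u) hZ
    simp only [hf] at hlt
    rw [Finset.sum_sub_distrib]
    linarith

/-- Raising prices on an excess-demand set does not overshoot a minimizer `q` of the Lyapunov
function: otherwise the part of `X` on which `p` and `q` agree could be dropped from `X`, which
by submodularity would lower the value at `q`. -/
theorem IsExcessDemand.add_chi_le (hA : ∀ b, MNatConcave A.u (A.v b)) {X : Finset N}
    (hX : A.IsExcessDemand p X) {q : N → ℤ} (hpq : p ≤ q)
    (hq : ∀ r, 0 ≤ r → A.lyapunov q ≤ A.lyapunov r) (hq0 : 0 ≤ q) : p + chi X ≤ q := by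
  by_contra hnot
  set Z : Finset N := X.filter fun i => q i = p i with hZ
  have hZne : Z.Nonempty := by
    rw [Pi.le_def, not_forall] at hnot
    obtain ⟨i, hi⟩ := hnot
    have hpqi : p i ≤ q i := hpq i
    refine ⟨i, ?_⟩
    simp only [Pi.add_apply, chi] at hi
    rw [hZ, Finset.mem_filter]
    split_ifs at hi with hiX
    · exact ⟨hiX, by omega⟩
    · omega
  have h1 := hX.2 Z (Finset.filter_subset _ _) hZne
  have h2 := lyapunov_submodular hA (p + chi X) q
  have e : (p + chi X) ⊓ q = p + chi (X \ Z) := by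
    ext i
    have := hpq i
    simp only [Pi.inf_apply, Pi.add_apply, chi, Finset.mem_sdiff, hZ, Finset.mem_filter]
    split_ifs <;> grind
  have h3 := hq ((p + chi X) ⊔ q) (hq0.trans le_sup_right)
  rw [e, lyapunov_add_chi hA, lyapunov_add_chi hA] at h2
  have := Finset.sum_sdiff (f := A.u) (Finset.filter_subset _ _ : Z ⊆ X)
  rw [Finset.sum_sub_distrib] at h1
  linarith

/-- The equilibrium prices are the nonnegative minimizers of the Lyapunov function, and these are
closed under meets by submodularity. -/
theorem exists_isLeast_equilibrium [Nonempty M] (hA : ∀ b, MNatConcave A.u (A.v b)) :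
    ∃ q, IsLeast {p | A.IsEquilibriumPrice p} q := by
  classical
  have hex : ∃ n : ℕ, ∃ p, 0 ≤ p ∧ A.lyapunov p = n :=
    ⟨_, 0, le_rfl, (Int.toNat_of_nonneg (lyapunov_nonneg le_rfl)).symm⟩
  obtain ⟨p₁, hp₁, hn⟩ := Nat.find_spec hex
  have hp₁min : ∀ q, 0 ≤ q → A.lyapunov p₁ ≤ A.lyapunov q := fun q hq => by
    have h0 := lyapunov_nonneg (A := A) hq
    have := Nat.find_min' hex ⟨q, hq, (Int.toNat_of_nonneg h0).symm⟩
    omega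
  have hex2 : ∃ n : ℕ, ∃ p, A.IsEquilibriumPrice p ∧ ∑ i, (p i).toNat = n :=
    ⟨_, p₁, isEquilibriumPrice_of_lyapunov_le hA hp₁ hp₁min, rfl⟩
  obtain ⟨q, hq, hqn⟩ := Nat.find_spec hex2
  refine ⟨q, hq, fun p hp => ?_⟩
  have hmeet0 : 0 ≤ q ⊓ p := le_inf hq.1 hp.1
  have hmeet : A.IsEquilibriumPrice (q ⊓ p) := by
    refine isEquilibriumPrice_of_lyapunov_le hA hmeet0 fun r _ => ?_
    have h1 := lyapunov_submodular hA q p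
    have h2 := hp.lyapunov_le (q ⊔ p)
    have h3 := hq.lyapunov_le r
    linarith
  have hle := Nat.find_min' hex2 ⟨q ⊓ p, hmeet, rfl⟩
  by_contra hnot
  rw [Pi.le_def, not_forall] at hnot
  obtain ⟨i, hi⟩ := hnot
  have : ∑ i, ((q ⊓ p) i).toNat < ∑ i, (q i).toNat := by
    refine Finset.sum_lt_sum (fun j _ => ?_) ⟨i, Finset.mem_univ i, ?_⟩
    · simp only [Pi.inf_apply]; omega
    · have := hp.1 i
      simp only [Pi.inf_apply, Pi.zero_apply] at *; omega
  omega

end MultiDemandModel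

/-! ### The ascending auction theorem -/

theorem mainTheorem1 {M N : Type*} [Fintype M] [Nonempty M] [Fintype N] [DecidableEq N]
    (A : MultiDemandModel M N) (hA : ∀ b, MNatConcave A.u (A.v b)) :
    ∃ pMin : N → ℤ, IsLeast {p | A.IsEquilibriumPrice p} pMin ∧
      ∀ p₀ : N → ℤ, 0 ≤ p₀ → p₀ ≤ pMin →
        A.AscendingAuctionFinds A.IsExcessDemand p₀ pMin := by
  obtain ⟨q, hq⟩ := MultiDemandModel.exists_isLeast_equilibrium hA
  have hqE : A.IsEquilibriumPrice q := hq.1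
  refine ⟨q, hq, fun p₀ hp₀ hp₀q => ?_⟩
  have hstep : ∀ p r, p ≤ q → A.AuctionStep A.IsExcessDemand p r → r ≤ q := by
    rintro p r hpq ⟨X, -, hX, rfl⟩
    exact hX.add_chi_le hA hpq (fun r _ => hqE.lyapunov_le r) hqE.1
  have hmono : ∀ p r, A.AuctionStep A.IsExcessDemand p r → p ≤ r := by
    rintro p r ⟨X, -, -, rfl⟩ i
    simp only [Pi.add_apply, chi]
    split_ifs <;> omega
  refine ⟨fun p _ hns => ?_, ?_, fun p hreach hfinal => ?_⟩
  · obtain ⟨X, h1, h2⟩ := MultiDemandModel.exists_isExcessDemand hns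
    exact ⟨_, X, h1, h2, rfl⟩
  · rintro ⟨P, hP0, hP⟩
    have hle : ∀ t, P t ≤ q := fun t => by
      induction t with
      | zero => exact hP0 ▸ hp₀q
      | succ t ih => exact hstep _ _ ih (hP t)
    have hgrow : ∀ t : ℕ, ∑ i, p₀ i + t ≤ ∑ i, P t i := fun t => by
      induction t with
      | zero => simp [hP0]
      | succ t ih =>
        obtain ⟨X, -, hX, he⟩ := hP t
        have h1 : (1 : ℤ) ≤ X.card := by exact_mod_cast hX.1.card_pos
        have h2 : ∑ i, chi X i = X.card := by simp [chi]
        rw [he]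
        simp only [Pi.add_apply, Finset.sum_add_distrib, h2]
        push_cast
        linarith
    have h1 := hgrow (∑ i, q i - ∑ i, p₀ i + 1).toNat
    have h2 : ∑ i, P _ i ≤ ∑ i, q i :=
      Finset.sum_le_sum fun i _ => hle (∑ i, q i - ∑ i, p₀ i + 1).toNat i
    have h3 := Int.self_le_toNat (∑ i, q i - ∑ i, p₀ i + 1)
    linarith
  · have hinv : p₀ ≤ p ∧ p ≤ q := by
      clear hfinal
      induction hreach with
      | refl => exact ⟨le_rfl, hp₀q⟩
      | tail _ hs ih => exact ⟨ih.1.trans (hmono _ _ hs), hstep _ _ ih.2 hs⟩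
    have hpE := MultiDemandModel.isEquilibriumPrice_of_lyapunov_le hA (hp₀.trans hinv.1)
      fun r _ => (hfinal.lyapunov_le hA hinv.2).trans (hqE.lyapunov_le r)
    exact le_antisymm hinv.2 (hq.2 hpE)
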